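/- Let $N$ be a natural number. For each vehicle $i\in\{1,\dots,N\}$ let $A_i\in\mathbb{R}^{n_i\times n_i}$, $B_i\in\mathbb{R}^{n_i\times m_i}$, and let $\mathcal{A}_i\subset\mathbb{R}^{m_i}$ be a nonempty convex set of controls such that the Hamiltonian $$H_i(x,p)=-x^{\top}A_i^{\top}p+\sup_{\alpha\in\mathcal{A}_i}\langle -B_i\alpha,p\rangle ,\qquad x,p\in\mathbb{R}^{n_i},$$ is finite for all $x,p$. For all $i,j\in\{1,\dots,N\}$ let $\Omega_{i,j}\subset\mathbb{R}^{n_i}$ be a closed convex goal set, and let $J_{i,j}:\mathbb{R}^{n_i}\to\mathbb{R}$ be a continuous convex function with $\Omega_{i,j}=\{x: J_{i,j}(x)\le 0\}$. Let $T$ be a real number (the time horizon), and let $\phi_{i,j}$ be a continuous viscosity solution on $\mathbb{R}^{n_i}\times[0,T]$ of $$\frac{\partial\phi_{i,j}}{\partial s}(x,s)+H_i\big(x,\nabla_x\phi_{i,j}(x,s)\big)=0\quad (0<s<T),\qquad \phi_{i,j}(x,0)=J_{i,j}(x).$$ Write $g^{\star}(p)=\sup_{y}\{\langle p,y\rangle-g(y)\}\in\mathbb{R}\cup\{+\infty\}$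 for the Fenchel–Legendre transform, and $$\widehat{H}_i(s,p)=\sup_{\alpha\in\mathcal{A}_i}\langle -e^{-sA_i}B_i\alpha,\,p\rangle .$$ Then for all $i,j$, all $x\in\mathbb{R}^{n_i}$ and all $t\in[0,T]$, the function $s\mapsto\widehat{H}_i(s,p)$ is integrable on $[0,t]$ for every $p\in\mathbb{R}^{n_i}$, and $$\phi_{i,j}(x,t)=-\min_{p\in\mathbb{R}^{n_i}}\Big\{J_{i,j}^{\star}\big(e^{-tA_i^{\top}}p\big)+\int_0^t\widehat{H}_i(s,p)\,ds-\langle x,p\rangle\Big\},$$ where the minimum is attained. -/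

import Mathlib

open scoped Matrix

noncomputable section

namespace VehicleHJ

/-- The state space `ℝⁿ` with its Euclidean norm and inner product. -/
abbrev Vec (n : ℕ) : Type := EuclideanSpace ℝ (Fin n)

/-- The matrix-vector product `M v`, on Euclidean spaces. -/
def act {k l : ℕ} (M : Matrix (Fin k) (Fin l) ℝ) (v : Vec l) : Vec k :=
  WithLp.toLp 2 (M *ᵥ WithLp.ofLp v)

/-- The Hamiltonian `H(x, p) = -xᵀ Aᵀ p + sup_{α ∈ U} ⟨-B α, p⟩` of a vehicle with dynamics
`x' = A x + B α`, `α ∈ U`. -/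
def hamiltonian {n m : ℕ} (A : Matrix (Fin n) (Fin n) ℝ) (B : Matrix (Fin n) (Fin m) ℝ)
    (U : Set (Vec m)) (x p : Vec n) : ℝ :=
  -inner ℝ x (act Aᵀ p) + ⨆ α : U, inner ℝ (-act B α) p

/-- The supremum in the Hamiltonian is a real number for every `p`, that is, the Hamiltonian
is real valued. -/
def HamiltonianFinite {n m : ℕ} (B : Matrix (Fin n) (Fin m) ℝ) (U : Set (Vec m)) : Prop :=
  U.Nonempty ∧ ∀ p : Vec n, BddAbove (Set.range fun α : U => inner ℝ (-act B α) p)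

/-- `φ` is a viscosity subsolution of `∂φ/∂s + H(x, ∇ₓφ) = 0` on `ℝⁿ × (0, T)`. -/
def IsViscositySubsolution {n : ℕ} (H : Vec n → Vec n → ℝ) (T : ℝ) (φ : Vec n × ℝ → ℝ) : Prop :=
  ∀ ψ : Vec n × ℝ → ℝ, ContDiff ℝ 1 ψ → ∀ (x : Vec n) (s : ℝ), s ∈ Set.Ioo 0 T →
    IsLocalMax (fun z => φ z - ψ z) (x, s) →
      deriv (fun r => ψ (x, r)) s + H x (gradient (fun y => ψ (y, s)) x) ≤ 0

/-- `φ` is a viscosity supersolution of `∂φ/∂s + H(x, ∇ₓφ) = 0` on `ℝⁿ × (0, T)`. -/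
def IsViscositySupersolution {n : ℕ} (H : Vec n → Vec n → ℝ) (T : ℝ) (φ : Vec n × ℝ → ℝ) : Prop :=
  ∀ ψ : Vec n × ℝ → ℝ, ContDiff ℝ 1 ψ → ∀ (x : Vec n) (s : ℝ), s ∈ Set.Ioo 0 T →
    IsLocalMin (fun z => φ z - ψ z) (x, s) →
      0 ≤ deriv (fun r => ψ (x, r)) s + H x (gradient (fun y => ψ (y, s)) x)

/-- `φ` is a (continuous) viscosity solution on `ℝⁿ × [0, T]` of the initial value problem
`∂φ/∂s + H(x, ∇ₓφ) = 0`, `φ(x, 0) = J(x)`. Values of `φ` at times outside `[0, T]` play no role. -/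
structure IsViscositySolution {n : ℕ} (H : Vec n → Vec n → ℝ) (J : Vec n → ℝ) (T : ℝ)
    (φ : Vec n × ℝ → ℝ) : Prop where
  continuousOn : ContinuousOn φ (Set.univ ×ˢ Set.Icc 0 T)
  initial : ∀ x, φ (x, 0) = J x
  subsolution : IsViscositySubsolution H T φ
  supersolution : IsViscositySupersolution H T φ

/-- The Fenchel-Legendre transform `g⋆(p) = sup_y (⟨p, y⟩ - g(y))`, with values in `ℝ ∪ {+∞}`. -/
def fenchel {n : ℕ} (g : Vec n → ℝ) (p : Vec n) : EReal :=
  ⨆ y : Vec n, ((inner ℝ p y - g y : ℝ) : EReal)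

/-- The transformed Hamiltonian `Ĥ(s, p) = sup_{α ∈ U} ⟨-e^{-sA} B α, p⟩`. -/
def transformedHamiltonian {n m : ℕ} (A : Matrix (Fin n) (Fin n) ℝ)
    (B : Matrix (Fin n) (Fin m) ℝ) (U : Set (Vec m)) (s : ℝ) (p : Vec n) : ℝ :=
  ⨆ α : U, inner ℝ (-act (NormedSpace.exp ((-s) • A)) (act B α)) p

/-- The function `p ↦ J⋆(e^{-tAᵀ} p) + ∫₀ᵗ Ĥ(s, p) ds - ⟨x, p⟩` minimized in the generalized Hopf
formula, with values in `ℝ ∪ {+∞}`. -/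
def hopfObjective {n m : ℕ} (A : Matrix (Fin n) (Fin n) ℝ)
    (B : Matrix (Fin n) (Fin m) ℝ) (U : Set (Vec m)) (J : Vec n → ℝ) (x : Vec n) (t : ℝ)
    (p : Vec n) : EReal :=
  fenchel J (act (NormedSpace.exp ((-t) • Aᵀ)) p)
    + (((∫ s in (0 : ℝ)..t, transformedHamiltonian A B U s p) - inner ℝ x p : ℝ) : EReal)

end VehicleHJ

end

/-! The Hamiltonian is `-⟪F x, p⟫ + h p` with `F` linear and `h` the support function of the vectors
`-B α`, hence Lipschitz in `p` with constant growing linearly in `x`. Comparing a viscosity solution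
with a `C¹` function therefore reduces to an eikonal inequality with finite propagation speed
(`nonpos_of_eikonal_subsolution`). No comparison between two viscosity solutions, and so no doubling
of variables, is required.

Write `Φ s = e^{sA}`. An affine minorant of `J` evolves explicitly into a classical solution below
`φ`; this gives one inequality for every `p` (`affine_le`). Conversely, paraboloids transported
along a controlled trajectory are classical supersolutions, so `φ (x, t)` is at most `J` at every
point of `Φ t x - R`, where `R` is the convex set of control integrals (`le_cost`). Hahn-Banach then
yields a single affine minorant of `J` that is at least `φ (x, t)` on all of `Φ t x - R`. Its slope
`q` closes the gap and shows attainment (`exists_affine_ge`). The stated formula follows by the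
substitution `q = e^{-tAᵀ} p` and time reversal. -/

namespace VehicleHJ

open Set Filter Topology ContinuousLinearMap

/-! ### Finite speed of propagation -/

section Comparison

variable {E : Type*} [NormedAddCommGroup E] [InnerProductSpace ℝ E] [FiniteDimensional ℝ E]

/-- Viscosity subsolutions of `w_s = C (1 + ‖x‖) ‖∇w‖` that are nonpositive at time `0` on a large
ball stay nonpositive at `x₀`: information travels with finite speed. -/
theorem nonpos_of_eikonal_subsolution {w : E × ℝ → ℝ} {T C : ℝ} (hC : 0 ≤ C)
    (hw : ContinuousOn w (univ ×ˢ Icc 0 T))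
    (hsub : ∀ ψ : E × ℝ → ℝ, ContDiff ℝ 1 ψ → ∀ (x : E) (s : ℝ), s ∈ Ioo 0 T →
      IsLocalMax (fun z => w z - ψ z) (x, s) →
        deriv (fun r => ψ (x, r)) s ≤ C * (1 + ‖x‖) * ‖gradient (fun y => ψ (y, s)) x‖)
    {x₀ : E} {t₀ : ℝ} (ht₀ : t₀ ∈ Icc 0 T)
    (h0 : ∀ y, ‖y‖ ≤ Real.exp (4 * C * T) * (1 + ‖x₀‖ ^ 2) + 1 → w (y, 0) ≤ 0) :
    w (x₀, t₀) ≤ 0 := by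
  have interior : ∀ t ∈ Ioo 0 T, w (x₀, t) ≤ 0 := by
    intro t ht
    by_contra! hpos
    obtain ⟨δ, hδ, hwδ⟩ : ∃ δ : ℝ, 0 < δ ∧ 2 * δ < w (x₀, t) :=
      ⟨w (x₀, t) / 4, by linarith, by linarith⟩
    obtain ⟨s', hs't, hs'T⟩ := exists_between ht.2
    -- The rate `4 * C` makes `∂g/∂s ≥ C (1 + ‖x‖) ‖∇g‖`, because `(1 + ‖x‖) ‖x‖ ≤ 2 (1 + ‖x‖²)`.
    -- Any increasing function of `g` inherits this.
    set g : E × ℝ → ℝ := fun z => Real.exp (4 * C * z.2) * (1 + ‖z.1‖ ^ 2) with hg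
    have hgc : ContDiff ℝ 1 g := by
      refine ContDiff.mul (by fun_prop) (contDiff_const.add (contDiff_fst.norm_sq ℝ))
    set R₀ := g (x₀, t) with hR₀
    have hR₀le : R₀ ≤ Real.exp (4 * C * T) * (1 + ‖x₀‖ ^ 2) := by
      simp only [hR₀, hg]
      have := ht.2.le
      gcongr
    set K : Set (E × ℝ) := {z | z.2 ∈ Icc 0 s' ∧ g z ≤ R₀ + 1} with hK
    have hnorm : ∀ z ∈ K, ‖z.1‖ ≤ R₀ + 1 := by
      rintro ⟨y, s⟩ ⟨hs, hle⟩
      refine le_trans ?_ hle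
      simp only [hg]
      have h1 : (1 : ℝ) ≤ Real.exp (4 * C * s) := Real.one_le_exp (by have := hs.1; positivity)
      nlinarith [sq_nonneg (‖y‖ - 1), sq_nonneg ‖y‖]
    have hKcompact : IsCompact K := by
      refine IsCompact.of_isClosed_subset
        ((isCompact_closedBall (0 : E) (R₀ + 1)).prod (isCompact_Icc (a := (0 : ℝ)) (b := s'))) ?_ ?_
      · exact (isClosed_Icc.preimage continuous_snd).inter
          (isClosed_le hgc.continuous continuous_const)
      · intro z hz
        exact ⟨by simpa using hnorm z hz, hz.1⟩
    have hKsub : K ⊆ univ ×ˢ Icc 0 T := fun z hz => ⟨mem_univ _, hz.1.1, hz.1.2.trans hs'T.le⟩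
    have hwK : ContinuousOn w K := hw.mono hKsub
    obtain ⟨M, hM⟩ := hKcompact.bddAbove_image hwK
    have hM' : ∀ z ∈ K, w z ≤ M := fun z hz => hM (mem_image_of_mem w hz)
    -- For such `k` the barrier `ψ` exceeds `w` on the lateral boundary `g = R₀ + 1` and on the top
    -- `s = s'`, while it equals only `2 * δ` at `(x₀, t)`. Thus `w - ψ` has an interior positive
    -- maximum, and the time term of `ψ` makes the supersolution inequality strict.
    obtain ⟨k, hk, hk1, hk2⟩ : ∃ k : ℝ, 0 < k ∧ M < δ * Real.exp (k * (s' - t)) ∧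
        M < δ * Real.exp (k * 1) := by
      have key : ∀ a : ℝ, 0 < a → ∀ᶠ k in atTop, M < δ * Real.exp (k * a) := fun a ha =>
        ((Real.tendsto_exp_atTop.comp (tendsto_id.atTop_mul_const ha)).const_mul_atTop
          hδ).eventually_gt_atTop M
      exact ((eventually_gt_atTop 0).and ((key _ (sub_pos.2 hs't)).and (key 1 one_pos))).exists
    set ψ : E × ℝ → ℝ := fun z =>
      δ * Real.exp (k * (g z - R₀)) + δ * Real.exp (k * (z.2 - t)) with hψ
    have hψc : ContDiff ℝ 1 ψ := by fun_prop
    have hmem : (x₀, t) ∈ K := ⟨⟨ht.1.le, hs't.le⟩, by linarith⟩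
    obtain ⟨⟨x, s⟩, hxs, hmax⟩ := hKcompact.exists_isMaxOn ⟨_, hmem⟩
      (f := fun z => w z - ψ z) (hwK.sub hψc.continuous.continuousOn)
    have hval : 0 < w (x, s) - ψ (x, s) := by
      have h1 : w (x₀, t) - ψ (x₀, t) ≤ w (x, s) - ψ (x, s) := hmax hmem
      have h2 : ψ (x₀, t) = 2 * δ := by simp [hψ, ← hR₀]; ring
      linarith
    have hs0 : 0 < s := by
      refine lt_of_le_of_ne hxs.1.1 ?_
      rintro rfl
      have h1 := h0 x ((hnorm _ hxs).trans (by linarith))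
      have h2 : 0 < ψ (x, 0) := by positivity
      linarith
    have hs1 : s < s' := by
      refine lt_of_le_of_ne hxs.1.2 ?_
      rintro rfl
      have h1 := hM' _ hxs
      have h2 : 0 < δ * Real.exp (k * (g (x, s) - R₀)) := by positivity
      have h3 : ψ (x, s) = δ * Real.exp (k * (g (x, s) - R₀)) + δ * Real.exp (k * (s - t)) := rfl
      linarith
    have hgR : g (x, s) < R₀ + 1 := by
      refine lt_of_le_of_ne hxs.2 ?_
      intro hgR
      have h1 := hM' _ hxs
      have h2 : 0 < δ * Real.exp (k * (s - t)) := by positivity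
      have h3 : ψ (x, s) = δ * Real.exp (k * (g (x, s) - R₀)) + δ * Real.exp (k * (s - t)) := rfl
      rw [hgR, add_sub_cancel_left] at h3
      linarith
    have hnhds : K ∈ 𝓝 (x, s) := by
      have ho : IsOpen {z : E × ℝ | z.2 ∈ Ioo 0 s' ∧ g z < R₀ + 1} :=
        (isOpen_Ioo.preimage continuous_snd).inter (isOpen_lt hgc.continuous continuous_const)
      exact mem_of_superset (ho.mem_nhds ⟨⟨hs0, hs1⟩, hgR⟩)
        fun z hz => ⟨Ioo_subset_Icc_self hz.1, hz.2.le⟩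
    have hineq := hsub ψ hψc x s ⟨hs0, hs1.trans hs'T⟩ (hmax.isLocalMax hnhds)
    set e := Real.exp (4 * C * s) with he
    set F := δ * k * Real.exp (k * (g (x, s) - R₀)) with hF
    have hderiv : HasDerivAt (fun r => ψ (x, r))
        (F * (4 * C * e * (1 + ‖x‖ ^ 2)) + δ * k * Real.exp (k * (s - t))) s := by
      have h1 : HasDerivAt (fun r => g (x, r)) (4 * C * e * (1 + ‖x‖ ^ 2)) s := by
        have := (((hasDerivAt_id s).const_mul (4 * C)).exp).mul_const (1 + ‖x‖ ^ 2)
        convert! this using 1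
        simp only [he, id]; ring
      have h2 := (((h1.sub_const R₀).const_mul k).exp).const_mul δ
      have h3 := ((((hasDerivAt_id s).sub_const t).const_mul k).exp).const_mul δ
      convert! h2.add h3 using 1
      simp [hF]; ring
    have hgrad : HasGradientAt (fun y => ψ (y, s)) ((F * (2 * e)) • x) x := by
      rw [hasGradientAt_iff_hasFDerivAt]
      have h1 : HasFDerivAt (fun y => g (y, s)) (e • (2 • innerSL ℝ x)) x :=
        (((hasStrictFDerivAt_norm_sq x).hasFDerivAt).const_add 1).const_mul e
      have h2 := ((((h1.sub_const R₀).const_mul k).exp).const_mul δ).add_const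
        (δ * Real.exp (k * (s - t)))
      convert! h2 using 1
      ext v
      simp [hF]; ring
    rw [hderiv.deriv, hgrad.gradient] at hineq
    have hFpos : 0 < F := by positivity
    have hepos : 0 < e := Real.exp_pos _
    rw [norm_smul, Real.norm_of_nonneg (by positivity)] at hineq
    have h4 : 0 < δ * k * Real.exp (k * (s - t)) := by positivity
    have h5 : C * (1 + ‖x‖) * (F * (2 * e) * ‖x‖) ≤ F * (4 * C * e * (1 + ‖x‖ ^ 2)) := by
      have h6 : (1 + ‖x‖) * ‖x‖ ≤ 2 * (1 + ‖x‖ ^ 2) := by nlinarith [sq_nonneg (‖x‖ - 1)]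
      have h7 : 0 ≤ 2 * C * F * e := by positivity
      nlinarith [mul_le_mul_of_nonneg_left h6 h7]
    linarith
  -- The viscosity inequality holds only at interior times: time `0` is read off the initial bound,
  -- and time `T` is reached by continuity.
  rcases eq_or_lt_of_le ht₀.1 with h | h
  · rw [← h]
    refine h0 x₀ ?_
    have h1 : (1 : ℝ) ≤ Real.exp (4 * C * T) :=
      Real.one_le_exp (by have := ht₀.1.trans ht₀.2; positivity)
    nlinarith [sq_nonneg (‖x₀‖ - 1), sq_nonneg ‖x₀‖]
  · have hT : 0 < T := h.trans_le ht₀.2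
    have hcont : ContinuousOn (fun s => w (x₀, s)) (Icc 0 T) :=
      hw.comp (by fun_prop) fun s hs => ⟨mem_univ _, hs⟩
    have hcl : closure (Ioo 0 T) = Icc 0 T := closure_Ioo hT.ne
    exact ContinuousWithinAt.closure_le (hcl ▸ ht₀)
      ((hcont t₀ ht₀).mono Ioo_subset_Icc_self) continuousWithinAt_const interior

end Comparison

/-! ### Support functions and near-maximizers -/

section SupportFunction

variable {E : Type*} [NormedAddCommGroup E] [InnerProductSpace ℝ E]

/-- The support function of a family of vectors. -/
noncomputable def supportFn {ι : Type*} (v : ι → E) (p : E) : ℝ := ⨆ i, inner ℝ (v i) p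

variable {ι : Type*} {v : ι → E}

theorem inner_le_supportFn (hv : ∀ p, BddAbove (range fun i => inner ℝ (v i) p)) (i : ι) (p : E) :
    inner ℝ (v i) p ≤ supportFn v p :=
  le_ciSup (hv p) i

/-- Uniform boundedness: one-sided bounds at `p` and `-p` give pointwise two-sided bounds. The
resulting `M` is the Lipschitz constant of the support function. -/
theorem exists_norm_le_of_bddAbove_inner [CompleteSpace E]
    (hv : ∀ p, BddAbove (range fun i => inner ℝ (v i) p)) : ∃ M, 0 ≤ M ∧ ∀ i, ‖v i‖ ≤ M := by
  obtain ⟨M, hM⟩ := banach_steinhaus (g := fun i => innerSL ℝ (v i)) (by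
    intro p
    obtain ⟨a, ha⟩ := hv p
    obtain ⟨b, hb⟩ := hv (-p)
    refine ⟨max a b, fun i => ?_⟩
    have h1 : inner ℝ (v i) p ≤ a := ha (mem_range_self i)
    have h2 : inner ℝ (v i) (-p) ≤ b := hb (mem_range_self i)
    rw [inner_neg_right] at h2
    rw [innerSL_apply_apply, Real.norm_eq_abs]
    exact abs_le.2 ⟨by linarith [le_max_right a b], h1.trans (le_max_left a b)⟩)
  exact ⟨max M 0, le_max_right _ _, fun i => by simpa using Or.inl (hM i)⟩

theorem supportFn_sub_le [Nonempty ι] (hv : ∀ p, BddAbove (range fun i => inner ℝ (v i) p))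
    {M : ℝ} (hM : ∀ i, ‖v i‖ ≤ M) (p q : E) :
    supportFn v p - supportFn v q ≤ M * ‖p - q‖ := by
  rw [sub_le_iff_le_add]
  refine ciSup_le fun i => ?_
  have h1 := inner_le_supportFn hv i q
  have h2 : inner ℝ (v i) (p - q) ≤ M * ‖p - q‖ :=
    (real_inner_le_norm _ _).trans (by have := hM i; gcongr)
  rw [inner_sub_right] at h2
  linarith

theorem continuous_supportFn [CompleteSpace E] [Nonempty ι]
    (hv : ∀ p, BddAbove (range fun i => inner ℝ (v i) p)) : Continuous (supportFn v) := by
  obtain ⟨M, hM0, hM⟩ := exists_norm_le_of_bddAbove_inner hv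
  refine (LipschitzWith.of_le_add_mul (K := M.toNNReal) fun p q => ?_).continuous
  rw [Real.coe_toNNReal _ hM0, dist_eq_norm]
  linarith [supportFn_sub_le hv hM p q]

/-- Almost maximizers of `c ↦ ⟪c, p⟫` over the convex set with support function `supportFn v` can
be chosen continuously in `p`. -/
theorem exists_continuous_supportFn_le_inner_add [CompleteSpace E] [Nonempty ι]
    (hv : ∀ p, BddAbove (range fun i => inner ℝ (v i) p)) {ε : ℝ} (hε : 0 < ε) :
    ∃ c : E → E, Continuous c ∧ (∀ p q, inner ℝ (c p) q ≤ supportFn v q) ∧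
      ∀ p, supportFn v p ≤ inner ℝ (c p) p + ε := by
  obtain ⟨M, hM0, hM⟩ := exists_norm_le_of_bddAbove_inner hv
  set K : Set E := {c | ∀ q, inner ℝ c q ≤ supportFn v q} with hK
  have hvK : ∀ i, v i ∈ K := fun i q => inner_le_supportFn hv i q
  have hKne : K.Nonempty := ⟨_, hvK (Classical.arbitrary ι)⟩
  have hKclosed : IsClosed K := by
    rw [hK, ofPred_forall]
    exact isClosed_iInter fun q => isClosed_le (by fun_prop) continuous_const
  have hKconv : Convex ℝ K := by
    intro a ha b hb α β hα hβ hαβ q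
    rw [inner_add_left, real_inner_smul_left, real_inner_smul_left]
    have h1 := mul_le_mul_of_nonneg_left (ha q) hα
    have h2 := mul_le_mul_of_nonneg_left (hb q) hβ
    calc _ ≤ α * supportFn v q + β * supportFn v q := add_le_add h1 h2
      _ = supportFn v q := by rw [← add_mul, hαβ, one_mul]
  have hKnorm : ∀ c ∈ K, ‖c‖ ≤ M := by
    intro c hc
    have h1 : supportFn v c ≤ M * ‖c‖ :=
      ciSup_le fun i => (real_inner_le_norm _ _).trans (by have := hM i; gcongr)
    have h2 := (hc c).trans h1
    rw [real_inner_self_eq_norm_sq] at h2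
    by_contra! h3
    nlinarith [norm_nonneg c]
  choose π hπK hπ using exists_norm_eq_iInf_of_complete_convex hKne hKclosed.isComplete hKconv
  have hπ' : ∀ u, ∀ w ∈ K, inner ℝ (u - π u) (w - π u) ≤ 0 := fun u =>
    (norm_eq_iInf_iff_real_inner_le_zero hKconv (hπK u)).1 (hπ u)
  have hπlip : LipschitzWith 1 π := by
    refine LipschitzWith.of_dist_le_mul fun a b => ?_
    rw [NNReal.coe_one, one_mul, dist_eq_norm, dist_eq_norm]
    have h1 := hπ' a (π b) (hπK b)
    have h2 := hπ' b (π a) (hπK a)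
    have h3 : ‖π a - π b‖ ^ 2 ≤ ‖a - b‖ * ‖π a - π b‖ := by
      refine le_trans ?_ (real_inner_le_norm _ _)
      rw [← real_inner_self_eq_norm_sq]
      simp only [inner_sub_left, inner_sub_right] at h1 h2 ⊢
      linarith [real_inner_comm (π a) (π b)]
    by_contra! h4
    nlinarith [norm_nonneg (a - b)]
  -- Projecting the far point `η⁻¹ • p` onto `K` nearly maximizes `⟪·, p⟫`: the variational
  -- inequality bounds the loss by `η * (2 * M ^ 2)`, and the projection is 1-Lipschitz.
  set η := ε / (2 * M ^ 2 + 1) with hη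
  have hηpos : 0 < η := by positivity
  refine ⟨fun p => π (η⁻¹ • p), hπlip.continuous.comp (by fun_prop), fun p => hπK _, fun p => ?_⟩
  refine ciSup_le fun i => ?_
  have h1 := hπ' (η⁻¹ • p) (v i) (hvK i)
  set c := π (η⁻¹ • p) with hc
  have h2 : inner ℝ c (v i - c) ≤ 2 * M ^ 2 := by
    refine (real_inner_le_norm _ _).trans ?_
    have h3 := hKnorm c (hπK _)
    have h4 := (norm_sub_le (v i) c).trans (add_le_add (hM i) h3)
    calc ‖c‖ * ‖v i - c‖ ≤ M * (M + M) := by gcongr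
      _ = 2 * M ^ 2 := by ring
  rw [inner_sub_left, real_inner_smul_left] at h1
  have h5 : inner ℝ p (v i - c) ≤ η * (2 * M ^ 2) := by
    have h6 : η⁻¹ * inner ℝ p (v i - c) ≤ 2 * M ^ 2 := by linarith
    rwa [inv_mul_le_iff₀ hηpos] at h6
  have h7 : η * (2 * M ^ 2) ≤ ε := by
    rw [hη, div_mul_eq_mul_div, div_le_iff₀ (by positivity)]
    nlinarith [sq_nonneg M]
  rw [inner_sub_right] at h5
  rw [real_inner_comm, real_inner_comm p c]
  linarith

end SupportFunction

/-! ### Comparison with classical sub- and supersolutions -/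

section SmoothComparison

variable {n : ℕ} {H : Vec n → Vec n → ℝ} {T C : ℝ} {φ u : Vec n × ℝ → ℝ}

theorem deriv_add_slice {u ψ : Vec n × ℝ → ℝ} (hu : ContDiff ℝ 1 u) (hψ : ContDiff ℝ 1 ψ)
    (x : Vec n) (s : ℝ) :
    deriv (fun r => u (x, r) + ψ (x, r)) s
      = deriv (fun r => u (x, r)) s + deriv (fun r => ψ (x, r)) s := by
  have h1 := (hu.differentiable one_ne_zero).comp (by fun_prop : Differentiable ℝ fun r : ℝ => (x, r))
  have h2 := (hψ.differentiable one_ne_zero).comp (by fun_prop : Differentiable ℝ fun r : ℝ => (x, r))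
  exact deriv_fun_add (h1 s) (h2 s)

theorem gradient_add_slice {u ψ : Vec n × ℝ → ℝ} (hu : ContDiff ℝ 1 u) (hψ : ContDiff ℝ 1 ψ)
    (x : Vec n) (s : ℝ) :
    gradient (fun y => u (y, s) + ψ (y, s)) x
      = gradient (fun y => u (y, s)) x + gradient (fun y => ψ (y, s)) x := by
  have h1 := (hu.differentiable one_ne_zero).comp
    (by fun_prop : Differentiable ℝ fun y : Vec n => (y, s))
  have h2 := (hψ.differentiable one_ne_zero).comp
    (by fun_prop : Differentiable ℝ fun y : Vec n => (y, s))
  have h3 := ((h1 x).hasFDerivAt.add (h2 x).hasFDerivAt).hasGradientAt.gradient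
  simp only [map_add] at h3
  exact h3

/-- A viscosity subsolution that is initially below a classical supersolution on a large ball stays
below it. -/
theorem IsViscositySubsolution.le_of_classical (hC : 0 ≤ C)
    (hH : ∀ x p q, H x p - H x q ≤ C * (1 + ‖x‖) * ‖p - q‖)
    (hφc : ContinuousOn φ (univ ×ˢ Icc 0 T)) (hφ : IsViscositySubsolution H T φ)
    (hu : ContDiff ℝ 1 u)
    (husuper : ∀ x s, 0 ≤ deriv (fun r => u (x, r)) s + H x (gradient (fun y => u (y, s)) x))
    {x₀ : Vec n} {t₀ : ℝ} (ht₀ : t₀ ∈ Icc 0 T)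
    (h0 : ∀ y, ‖y‖ ≤ Real.exp (4 * C * T) * (1 + ‖x₀‖ ^ 2) + 1 → φ (y, 0) ≤ u (y, 0)) :
    φ (x₀, t₀) ≤ u (x₀, t₀) := by
  refine sub_nonpos.1 (nonpos_of_eikonal_subsolution (w := fun z => φ z - u z) hC
    (hφc.sub hu.continuous.continuousOn) ?_ ht₀ fun y hy => sub_nonpos.2 (h0 y hy))
  intro ψ hψ x s hs hmax
  -- A test function `ψ` for `φ - u` becomes the test function `u + ψ` for `φ`; the Lipschitz bound
  -- on `H` then leaves only `‖∇ψ‖`.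
  have h1 := hφ (fun z => u z + ψ z) (hu.add hψ) x s hs (by simpa only [sub_sub] using hmax)
  rw [deriv_add_slice hu hψ, gradient_add_slice hu hψ] at h1
  have h2 := hH x (gradient (fun y => u (y, s)) x)
    (gradient (fun y => u (y, s)) x + gradient (fun y => ψ (y, s)) x)
  rw [sub_add_cancel_left, norm_neg] at h2
  linarith [husuper x s]

/-- A viscosity supersolution that is initially above a classical subsolution stays above it. -/
theorem IsViscositySupersolution.ge_of_classical (hC : 0 ≤ C)
    (hH : ∀ x p q, H x p - H x q ≤ C * (1 + ‖x‖) * ‖p - q‖)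
    (hφc : ContinuousOn φ (univ ×ˢ Icc 0 T)) (hφ : IsViscositySupersolution H T φ)
    (hu : ContDiff ℝ 1 u)
    (husub : ∀ x s, deriv (fun r => u (x, r)) s + H x (gradient (fun y => u (y, s)) x) ≤ 0)
    {x₀ : Vec n} {t₀ : ℝ} (ht₀ : t₀ ∈ Icc 0 T) (h0 : ∀ y, u (y, 0) ≤ φ (y, 0)) :
    u (x₀, t₀) ≤ φ (x₀, t₀) := by
  refine sub_nonpos.1 (nonpos_of_eikonal_subsolution (w := fun z => u z - φ z) hC
    (hu.continuous.continuousOn.sub hφc) ?_ ht₀ fun y _ => sub_nonpos.2 (h0 y))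
  intro ψ hψ x s hs hmax
  have h1 := hφ (fun z => u z + -ψ z) (hu.add hψ.neg) x s hs (by
    filter_upwards [hmax] with z hz
    linarith)
  rw [deriv_add_slice hu hψ.neg, gradient_add_slice hu hψ.neg] at h1
  have h3 : gradient (fun y => -ψ (y, s)) x = -gradient (fun y => ψ (y, s)) x := by
    simp [gradient]
  have h4 : deriv (fun r => -ψ (x, r)) s = -deriv (fun r => ψ (x, r)) s := by simp
  rw [h3, h4] at h1
  have h2 := hH x (gradient (fun y => u (y, s)) x + -gradient (fun y => ψ (y, s)) x)
    (gradient (fun y => u (y, s)) x)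
  rw [add_sub_cancel_left, norm_neg] at h2
  linarith [husub x s]

end SmoothComparison

/-! ### Explicit classical solutions along the linear flow -/

section Flow

variable {n : ℕ} {F : Vec n →L[ℝ] Vec n} {Φ : ℝ → Vec n →L[ℝ] Vec n}

theorem contDiff_of_hasDerivAt_mul (hΦ : ∀ s, HasDerivAt Φ (Φ s * F) s) : ContDiff ℝ 1 Φ := by
  have hd : Differentiable ℝ Φ := fun s => (hΦ s).differentiableAt
  refine contDiff_one_iff_deriv.2 ⟨hd, ?_⟩
  have h : deriv Φ = fun s => Φ s * F := funext fun s => (hΦ s).deriv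
  rw [h]
  exact hd.continuous.mul continuous_const

theorem contDiff_intervalIntegral {G : Type*} [NormedAddCommGroup G] [NormedSpace ℝ G]
    [CompleteSpace G] {f : ℝ → G} (hf : Continuous f) :
    ContDiff ℝ 1 fun s => ∫ r in (0 : ℝ)..s, f r := by
  have h : ∀ s, HasDerivAt (fun s => ∫ r in (0 : ℝ)..s, f r) (f s) s := fun s =>
    intervalIntegral.integral_hasDerivAt_right (hf.intervalIntegrable _ _)
      (hf.stronglyMeasurableAtFilter _ _) hf.continuousAt
  refine contDiff_one_iff_deriv.2 ⟨fun s => (h s).differentiableAt, ?_⟩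
  rwa [funext fun s => (h s).deriv]

variable {h : Vec n → ℝ} {J : Vec n → ℝ} {T M : ℝ} {φ : Vec n × ℝ → ℝ}

theorem linear_hamiltonian_sub_le (hh : ∀ p q, h p - h q ≤ M * ‖p - q‖) (x p q : Vec n) :
    (-inner ℝ (F x) p + h p) - (-inner ℝ (F x) q + h q)
      ≤ max ‖F‖ M * (1 + ‖x‖) * ‖p - q‖ := by
  have h1 : inner ℝ (F x) (q - p) ≤ ‖F‖ * ‖x‖ * ‖p - q‖ := by
    rw [norm_sub_rev p q]
    exact (real_inner_le_norm _ _).trans (by have := F.le_opNorm x; gcongr)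
  have h2 := hh p q
  have h3 : ‖F‖ * ‖x‖ * ‖p - q‖ ≤ max ‖F‖ M * ‖x‖ * ‖p - q‖ := by
    have := le_max_left ‖F‖ M
    gcongr
  have h4 : M * ‖p - q‖ ≤ max ‖F‖ M * ‖p - q‖ := by
    have := le_max_right ‖F‖ M
    gcongr
  rw [inner_sub_right] at h1
  linarith

/-- A viscosity supersolution with initial value `J` lies above the classical solution with affine
initial value `⟪·, q⟫ - κ`, for every affine minorant `⟪·, q⟫ - κ` of `J`. -/
theorem IsViscositySupersolution.affine_le (hΦ0 : Φ 0 = 1)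
    (hΦ : ∀ s, HasDerivAt Φ (Φ s * F) s) (hhc : Continuous h)
    (hh : ∀ p q, h p - h q ≤ M * ‖p - q‖)
    (hφc : ContinuousOn φ (univ ×ˢ Icc 0 T)) (hφ0 : ∀ x, φ (x, 0) = J x)
    (hφ : IsViscositySupersolution (fun x p => -inner ℝ (F x) p + h p) T φ)
    {q : Vec n} {κ : ℝ} (hκ : ∀ y, inner ℝ q y - J y ≤ κ)
    {x : Vec n} {t : ℝ} (ht : t ∈ Icc 0 T) :
    inner ℝ (Φ t x) q - κ - (∫ r in (0 : ℝ)..t, h (adjoint (Φ r) q)) ≤ φ (x, t) := by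
  have hΦc := contDiff_of_hasDerivAt_mul hΦ
  have hcont : Continuous fun r => h (adjoint (Φ r) q) :=
    hhc.comp (((adjoint (𝕜 := ℝ) (E := Vec n) (F := Vec n)).continuous.comp
      hΦc.continuous).clm_apply continuous_const)
  refine hφ.ge_of_classical (C := max ‖F‖ M)
    (u := fun z => inner ℝ (Φ z.2 z.1) q - κ - ∫ r in (0 : ℝ)..z.2, h (adjoint (Φ r) q))
    (le_max_of_le_left (norm_nonneg F)) (linear_hamiltonian_sub_le hh) hφc ?_ ?_ ht ?_
  · exact ((((hΦc.comp contDiff_snd).clm_apply contDiff_fst).inner ℝ contDiff_const).sub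
      contDiff_const).sub ((contDiff_intervalIntegral hcont).comp contDiff_snd)
  · intro x s
    have h1 : HasDerivAt
        (fun r => inner ℝ (Φ r x) q - κ - ∫ r in (0 : ℝ)..r, h (adjoint (Φ r) q))
        (inner ℝ (Φ s (F x)) q - h (adjoint (Φ s) q)) s := by
      have h2 : HasDerivAt (fun r => inner ℝ (Φ r x) q) (inner ℝ (Φ s (F x)) q) s := by
        have h3 := ((hΦ s).clm_apply (hasDerivAt_const s x)).inner ℝ (hasDerivAt_const s q)
        simpa using h3
      exact (h2.sub_const κ).sub (intervalIntegral.integral_hasDerivAt_right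
        (hcont.intervalIntegrable _ _) (hcont.stronglyMeasurableAtFilter _ _) hcont.continuousAt)
    have h4 : HasGradientAt
        (fun y => inner ℝ (Φ s y) q - κ - ∫ r in (0 : ℝ)..s, h (adjoint (Φ r) q))
        (adjoint (Φ s) q) x := by
      rw [hasGradientAt_iff_hasFDerivAt]
      have h5 : HasFDerivAt (fun y => inner ℝ (adjoint (Φ s) q) y)
          (InnerProductSpace.toDual ℝ (Vec n) (adjoint (Φ s) q)) x :=
        (InnerProductSpace.toDual ℝ (Vec n) (adjoint (Φ s) q)).hasFDerivAt
      have h6 : ∀ y, inner ℝ (Φ s y) q = inner ℝ (adjoint (Φ s) q) y := fun y => by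
        rw [adjoint_inner_left, real_inner_comm]
      simp only [h6]
      exact (h5.sub_const κ).sub_const _
    rw [h1.deriv, h4.gradient, adjoint_inner_right]
    linarith
  · intro y
    have := hκ y
    simp only [hΦ0, one_apply_eq_self, intervalIntegral.integral_same, hφ0]
    rw [real_inner_comm]
    linarith

/-- A viscosity subsolution with initial value `J` is at most the cost of every trajectory of the
controlled dynamics. -/
theorem IsViscositySubsolution.le_cost (hΦ0 : Φ 0 = 1)
    (hΦ : ∀ s, HasDerivAt Φ (Φ s * F) s)
    (hh : ∀ p q, h p - h q ≤ M * ‖p - q‖) (hJ : Continuous J)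
    (hφc : ContinuousOn φ (univ ×ˢ Icc 0 T)) (hφ0 : ∀ x, φ (x, 0) = J x)
    (hφ : IsViscositySubsolution (fun x p => -inner ℝ (F x) p + h p) T φ)
    {c : ℝ → Vec n} (hc : Continuous c) (hch : ∀ r q, inner ℝ (c r) q ≤ h q)
    {x : Vec n} {t : ℝ} (ht : t ∈ Icc 0 T) :
    φ (x, t) ≤ J (Φ t x - ∫ r in (0 : ℝ)..t, Φ r (c r)) := by
  have hΦc := contDiff_of_hasDerivAt_mul hΦ
  have hcont : Continuous fun r => Φ r (c r) := hΦc.continuous.clm_apply hc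
  set b : ℝ → Vec n := fun s => ∫ r in (0 : ℝ)..s, Φ r (c r) with hb
  have hbderiv : ∀ s, HasDerivAt b (Φ s (c s)) s := fun s =>
    intervalIntegral.integral_hasDerivAt_right (hcont.intervalIntegrable _ _)
      (hcont.stronglyMeasurableAtFilter _ _) hcont.continuousAt
  set y₀ := Φ t x - b t with hy₀
  change φ (x, t) ≤ J y₀
  refine le_of_forall_pos_le_add fun ε hε => ?_
  set C := max ‖F‖ M with hC
  set R := Real.exp (4 * C * T) * (1 + ‖x‖ ^ 2) + 1 with hR
  -- `J` need not be differentiable, so it is replaced by a paraboloid centred at the endpoint `y₀`.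
  -- Domination is needed only on the ball of radius `R` seen by the comparison lemma, where `J` is
  -- bounded.
  obtain ⟨K, hK0, hK⟩ : ∃ K : ℝ, 0 ≤ K ∧
      ∀ y, ‖y‖ ≤ R → J y ≤ J y₀ + ε + K * ‖y - y₀‖ ^ 2 := by
    obtain ⟨η, hη, hJη⟩ := Metric.continuousAt_iff.1 hJ.continuousAt ε hε
    obtain ⟨m, hm⟩ := (isCompact_closedBall (0 : Vec n) R).bddAbove_image hJ.continuousOn
    refine ⟨max 0 ((m - J y₀) / η ^ 2), le_max_left _ _, fun y hy => ?_⟩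
    rcases lt_or_ge ‖y - y₀‖ η with hlt | hge
    · have h1 := hJη (x := y) (by rwa [dist_eq_norm])
      rw [Real.dist_eq] at h1
      have h2 : 0 ≤ max 0 ((m - J y₀) / η ^ 2) * ‖y - y₀‖ ^ 2 :=
        mul_nonneg (le_max_left _ _) (sq_nonneg _)
      linarith [(abs_lt.1 h1).2]
    · have h1 : J y ≤ m := hm (mem_image_of_mem J (by simpa using hy))
      have h2 : max 0 ((m - J y₀) / η ^ 2) * η ^ 2
          ≤ max 0 ((m - J y₀) / η ^ 2) * ‖y - y₀‖ ^ 2 := by gcongr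
      have h3 : m - J y₀ ≤ max 0 ((m - J y₀) / η ^ 2) * η ^ 2 := by
        rw [← div_le_iff₀ (by positivity)]
        exact le_max_right _ _
      linarith
  have key : φ (x, t) ≤ J y₀ + ε + K * ‖Φ t x - b t - y₀‖ ^ 2 := by
    refine hφ.le_of_classical (C := C)
      (u := fun z => J y₀ + ε + K * ‖Φ z.2 z.1 - b z.2 - y₀‖ ^ 2)
      (le_max_of_le_left (norm_nonneg F)) (linear_hamiltonian_sub_le hh) hφc ?_ ?_ ht ?_
    · have h1 : ContDiff ℝ 1 fun z : Vec n × ℝ => Φ z.2 z.1 - b z.2 - y₀ :=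
        (((hΦc.comp contDiff_snd).clm_apply contDiff_fst).sub
          ((contDiff_intervalIntegral hcont).comp contDiff_snd)).sub contDiff_const
      exact contDiff_const.add (contDiff_const.mul (h1.norm_sq ℝ))
    · intro x s
      set z := Φ s x - b s - y₀ with hz
      have h1 : HasDerivAt (fun r => J y₀ + ε + K * ‖Φ r x - b r - y₀‖ ^ 2)
          (K * (2 * inner ℝ z (Φ s (F x) - Φ s (c s)))) s := by
        have h2 : HasDerivAt (fun r => Φ r x - b r - y₀) (Φ s (F x) - Φ s (c s)) s := by
          have h3 := (hΦ s).clm_apply (hasDerivAt_const s x)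
          simp only [map_zero, add_zero] at h3
          exact (h3.sub (hbderiv s)).sub_const y₀
        exact (h2.norm_sq.const_mul K).const_add _
      have h4 : HasGradientAt (fun y => J y₀ + ε + K * ‖Φ s y - b s - y₀‖ ^ 2)
          ((2 * K) • adjoint (Φ s) z) x := by
        rw [hasGradientAt_iff_hasFDerivAt]
        have h5 : HasFDerivAt (fun y => Φ s y - b s - y₀) (Φ s) x :=
          ((Φ s).hasFDerivAt.sub_const _).sub_const _
        have h6 := (h5.norm_sq.const_mul K).const_add (J y₀ + ε)
        convert! h6 using 1
        ext v
        simp [adjoint_inner_left, ← hz]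
        ring
      rw [h1.deriv, h4.gradient]
      have h7 := hch s ((2 * K) • adjoint (Φ s) z)
      rw [real_inner_smul_right, adjoint_inner_right] at h7
      rw [real_inner_smul_right, adjoint_inner_right, inner_sub_right,
        real_inner_comm (Φ s (F x)), real_inner_comm (Φ s (c s))]
      linarith
    · intro y hy
      have h1 : b 0 = 0 := by simp [hb]
      simp only [hΦ0, one_apply_eq_self, h1, sub_zero, hφ0]
      exact hK y hy
  simpa [hy₀] using key

end Flow

/-! ### Separation and affine minorants -/

section Duality

variable {E : Type*} [NormedAddCommGroup E] [InnerProductSpace ℝ E] [CompleteSpace E]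

/-- If the convex function `J` is at least `m` on the convex set `y - R`, then some affine minorant
of `J` is at least `m` on `y - R`. -/
theorem exists_affine_minorant_ge_on {J : E → ℝ} (hJc : Continuous J)
    (hJ : ConvexOn ℝ univ J) {R : Set E} (hR : Convex ℝ R) (hRne : R.Nonempty) {y : E} {m : ℝ}
    (hm : ∀ r ∈ R, m ≤ J (y - r)) :
    ∃ q : E, ∀ z, ∀ r ∈ R, inner ℝ q z - J z ≤ inner ℝ q (y - r) - m := by
  set S : Set (E × ℝ) := {p | J p.1 < p.2} with hS
  -- The strict epigraph `S` is open and misses this hypograph of the constant `m` over `y - R`; a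
  -- separating hyperplane is the graph of the desired minorant.
  set D : Set (E × ℝ) := {p | y - p.1 ∈ R ∧ p.2 ≤ m} with hD
  have hSconv : Convex ℝ S := by simpa [hS] using hJ.convex_strict_epigraph
  have hSopen : IsOpen S := isOpen_lt (hJc.comp continuous_fst) continuous_snd
  have hDconv : Convex ℝ D := by
    rintro ⟨a, a'⟩ ⟨ha, ha'⟩ ⟨b, b'⟩ ⟨hb, hb'⟩ α β hα hβ hαβ
    refine ⟨?_, ?_⟩
    · have h1 : y - (α • a + β • b) = α • (y - a) + β • (y - b) := by
        rw [smul_sub, smul_sub, sub_add_sub_comm, ← add_smul, hαβ, one_smul]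
      change y - (α • a + β • b) ∈ R
      rw [h1]
      exact hR ha hb hα hβ hαβ
    · change α * a' + β * b' ≤ m
      calc α * a' + β * b' ≤ α * m + β * m := by
            have h1 : a' ≤ m := ha'
            have h2 : b' ≤ m := hb'
            gcongr
        _ = m := by rw [← add_mul, hαβ, one_mul]
  have hdisj : Disjoint S D := by
    rw [Set.disjoint_left]
    rintro ⟨a, a'⟩ h1 ⟨h2, h3⟩
    have h4 := hm _ h2
    rw [sub_sub_cancel] at h4
    have h5 : J a < a' := h1
    exact absurd (h5.trans_le h3) (not_lt.2 h4)
  obtain ⟨f, u, hfS, hfD⟩ := geometric_hahn_banach_open hSconv hSopen hDconv hdisj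
  set ℓ : E →L[ℝ] ℝ := f.comp (ContinuousLinearMap.inl ℝ E ℝ) with hℓ
  set μ : ℝ := f (0, 1) with hμ
  have hf : ∀ z a, f (z, a) = ℓ z + a * μ := by
    intro z a
    have h1 : ((z, a) : E × ℝ) = (z, 0) + a • (0, 1) := by simp
    rw [h1, map_add, map_smul]
    simp [hℓ, hμ]
  obtain ⟨r₀, hr₀⟩ := hRne
  have hsep : ∀ z a, J z < a → ∀ r ∈ R, ℓ z + a * μ < ℓ (y - r) + m * μ := by
    intro z a hza r hr
    rw [← hf, ← hf]
    exact (hfS (z, a) hza).trans_le (hfD (y - r, m) ⟨by simpa using hr, le_refl m⟩)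
  -- The hyperplane is not vertical: `S` and `D` both have points over `y - r₀`, and `f` separates
  -- them strictly.
  have hμneg : μ < 0 := by
    have h1 := hsep (y - r₀) (max (J (y - r₀)) m + 1)
      (lt_of_le_of_lt (le_max_left _ _) (lt_add_one _)) r₀ hr₀
    have h2 : 0 < max (J (y - r₀)) m + 1 - m := by linarith [le_max_right (J (y - r₀)) m]
    by_contra! h3
    nlinarith [mul_nonneg h2.le h3]
  refine ⟨(-μ)⁻¹ • (InnerProductSpace.toDual ℝ E).symm ℓ, fun z r hr => ?_⟩
  have hμ' : 0 < -μ := by linarith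
  rw [real_inner_smul_left, real_inner_smul_left, InnerProductSpace.toDual_symm_apply,
    InnerProductSpace.toDual_symm_apply]
  refine le_of_forall_pos_le_add fun ε hε => ?_
  have h1 := hsep z (J z + ε) (by linarith) r hr
  have h2 : (-μ)⁻¹ * (ℓ z - ℓ (y - r)) ≤ J z + ε - m := by
    rw [inv_mul_le_iff₀ hμ']
    linarith
  linarith

end Duality

/-! ### Existence of an optimal slope -/

section Hopf

variable {n : ℕ} {F : Vec n →L[ℝ] Vec n} {Φ : ℝ → Vec n →L[ℝ] Vec n}
  {ι : Type*} [Nonempty ι] {v : ι → Vec n} {J : Vec n → ℝ} {T : ℝ} {φ : Vec n × ℝ → ℝ}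

/-- Some affine minorant of `J` generates a classical solution that is at least the viscosity
subsolution `φ` at the point `(x, t)`. -/
theorem IsViscositySubsolution.exists_affine_ge (hΦ0 : Φ 0 = 1)
    (hΦ : ∀ s, HasDerivAt Φ (Φ s * F) s)
    (hv : ∀ p, BddAbove (range fun i => inner ℝ (v i) p)) (hJc : Continuous J)
    (hJ : ConvexOn ℝ univ J)
    (hφc : ContinuousOn φ (univ ×ˢ Icc 0 T)) (hφ0 : ∀ x, φ (x, 0) = J x)
    (hφ : IsViscositySubsolution (fun x p => -inner ℝ (F x) p + supportFn v p) T φ)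
    (x : Vec n) {t : ℝ} (ht : t ∈ Icc 0 T) :
    ∃ q, ∀ y, inner ℝ q y - J y ≤ inner ℝ (Φ t x) q
      - (∫ r in (0 : ℝ)..t, supportFn v (adjoint (Φ r) q)) - φ (x, t) := by
  obtain ⟨M, -, hM⟩ := exists_norm_le_of_bddAbove_inner hv
  have hΦc := (contDiff_of_hasDerivAt_mul hΦ).continuous
  set R : Set (Vec n) := {w | ∃ c : ℝ → Vec n, Continuous c ∧
    (∀ r q, inner ℝ (c r) q ≤ supportFn v q) ∧ w = ∫ r in (0 : ℝ)..t, Φ r (c r)} with hR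
  have hRconv : Convex ℝ R := by
    rintro _ ⟨c, hc, hcv, rfl⟩ _ ⟨d, hd, hdv, rfl⟩ α β hα hβ hαβ
    refine ⟨fun r => α • c r + β • d r, by fun_prop, fun r q => ?_, ?_⟩
    · rw [inner_add_left, real_inner_smul_left, real_inner_smul_left]
      calc _ ≤ α * supportFn v q + β * supportFn v q :=
            add_le_add (mul_le_mul_of_nonneg_left (hcv r q) hα)
              (mul_le_mul_of_nonneg_left (hdv r q) hβ)
        _ = supportFn v q := by rw [← add_mul, hαβ, one_mul]
    · simp only [map_add, map_smul]
      have hi : ∀ (a : ℝ) {e : ℝ → Vec n}, Continuous e →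
          IntervalIntegrable (fun r => a • Φ r (e r)) MeasureTheory.volume 0 t := fun a _ he =>
        ((hΦc.clm_apply he).const_smul a).intervalIntegrable _ _
      rw [intervalIntegral.integral_add (hi α hc) (hi β hd), intervalIntegral.integral_smul, intervalIntegral.integral_smul]
  have hRne : R.Nonempty := ⟨_, fun _ => v (Classical.arbitrary ι), continuous_const,
    fun _ q => inner_le_supportFn hv _ q, rfl⟩
  obtain ⟨q, hq⟩ := exists_affine_minorant_ge_on hJc hJ hRconv hRne (y := Φ t x) (m := φ (x, t)) (by
    rintro _ ⟨c, hc, hcv, rfl⟩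
    exact hφ.le_cost hΦ0 hΦ (supportFn_sub_le hv hM) hJc hφc hφ0 hc hcv ht)
  refine ⟨q, fun y => le_of_forall_pos_le_add fun ε hε => ?_⟩
  -- The near-maximizer, evaluated along `r ↦ adjoint (Φ r) q`, is a continuous control whose
  -- integral attains `∫ h` up to `ε`. Dividing by `t + 1` also covers `t = 0`.
  have hε' : 0 < ε / (t + 1) := by have := ht.1; positivity
  obtain ⟨c, hc, hcv, hcε⟩ := exists_continuous_supportFn_le_inner_add hv hε'
  have hadj : Continuous fun r => adjoint (Φ r) q :=
    ((adjoint (𝕜 := ℝ) (E := Vec n) (F := Vec n)).continuous.comp hΦc).clm_apply continuous_const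
  have hcr : Continuous fun r => c (adjoint (Φ r) q) := hc.comp hadj
  have hint : Continuous fun r => Φ r (c (adjoint (Φ r) q)) := hΦc.clm_apply hcr
  have h1 := hq y _ ⟨fun r => c (adjoint (Φ r) q), hcr, fun r => hcv _, rfl⟩
  have h2 : inner ℝ q (∫ r in (0 : ℝ)..t, Φ r (c (adjoint (Φ r) q)))
      = ∫ r in (0 : ℝ)..t, inner ℝ q (Φ r (c (adjoint (Φ r) q))) :=
    ((innerSL ℝ q).intervalIntegral_comp_comm (hint.intervalIntegrable _ _)).symm
  have h3 : (∫ r in (0 : ℝ)..t, supportFn v (adjoint (Φ r) q))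
      ≤ ∫ r in (0 : ℝ)..t, (inner ℝ q (Φ r (c (adjoint (Φ r) q))) + ε / (t + 1)) := by
    refine intervalIntegral.integral_mono_on ht.1
      (((continuous_supportFn hv).comp hadj).intervalIntegrable _ _)
      (((continuous_const.inner hint).add continuous_const).intervalIntegrable _ _)
      fun r _ => ?_
    have h4 := hcε (adjoint (Φ r) q)
    rwa [adjoint_inner_right, real_inner_comm] at h4
  rw [intervalIntegral.integral_add ((continuous_const.inner hint).intervalIntegrable _ _)
    (continuous_const.intervalIntegrable _ _), intervalIntegral.integral_const, ← h2,
    smul_eq_mul, sub_zero] at h3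
  have h5 : t * (ε / (t + 1)) ≤ ε := by
    have := ht.1
    rw [mul_div_assoc', div_le_iff₀ (by positivity)]
    nlinarith
  rw [inner_sub_right] at h1
  beta_reduce at h1
  rw [real_inner_comm q (Φ t x)]
  linarith

end Hopf

/-! ### Translation to matrix exponentials and conclusion -/

section Matrices

variable {n : ℕ}

/-- The flow `s ↦ e^{sA}` as a curve of operators. -/
noncomputable def flow (A : Matrix (Fin n) (Fin n) ℝ) (s : ℝ) : Vec n →L[ℝ] Vec n :=
  Matrix.toEuclideanCLM (n := Fin n) (𝕜 := ℝ) (NormedSpace.exp (s • A))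

theorem flow_zero (A : Matrix (Fin n) (Fin n) ℝ) : flow A 0 = 1 := by
  simp [flow]

open scoped Matrix.Norms.Operator in
theorem hasDerivAt_flow (A : Matrix (Fin n) (Fin n) ℝ) (s : ℝ) :
    HasDerivAt (flow A) (flow A s * Matrix.toEuclideanCLM (n := Fin n) (𝕜 := ℝ) A) s := by
  have h1 := hasDerivAt_exp_smul_const (𝕂 := ℝ) A s
  have h2 := (LinearMap.toContinuousLinearMap (Matrix.toEuclideanCLM (n := Fin n) (𝕜 := ℝ) :
    Matrix (Fin n) (Fin n) ℝ →ₗ[ℝ] Vec n →L[ℝ] Vec n)).hasFDerivAt.comp_hasDerivAt s h1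
  rw [flow, ← map_mul]
  exact h2

theorem adjoint_toEuclideanCLM (M : Matrix (Fin n) (Fin n) ℝ) :
    adjoint (Matrix.toEuclideanCLM (n := Fin n) (𝕜 := ℝ) M)
      = Matrix.toEuclideanCLM (n := Fin n) (𝕜 := ℝ) Mᵀ := by
  rw [← star_eq_adjoint, ← map_star, Matrix.star_eq_conjTranspose,
    Matrix.conjTranspose_eq_transpose_of_trivial]

theorem adjoint_flow (A : Matrix (Fin n) (Fin n) ℝ) (s : ℝ) :
    adjoint (flow A s) = flow Aᵀ s := by
  rw [flow, adjoint_toEuclideanCLM, ← Matrix.exp_transpose, Matrix.transpose_smul, flow]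

theorem flow_add (A : Matrix (Fin n) (Fin n) ℝ) (r s : ℝ) :
    flow A (r + s) = flow A r * flow A s := by
  rw [flow, flow, flow, ← map_mul, add_smul, Matrix.exp_add_of_commute]
  exact ((Commute.refl A).smul_left r).smul_right s

theorem flow_flow_neg (A : Matrix (Fin n) (Fin n) ℝ) (t : ℝ) (p : Vec n) :
    flow A t (flow A (-t) p) = p := by
  rw [← mul_apply_eq_comp, ← flow_add, add_neg_cancel, flow_zero,
    one_apply_eq_self]

theorem continuous_flow (A : Matrix (Fin n) (Fin n) ℝ) : Continuous (flow A) :=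
  (contDiff_of_hasDerivAt_mul (hasDerivAt_flow A)).continuous

theorem act_exp (A : Matrix (Fin n) (Fin n) ℝ) (s : ℝ) (p : Vec n) :
    act (NormedSpace.exp (s • A)) p = flow A s p := rfl

variable {m : ℕ} (A : Matrix (Fin n) (Fin n) ℝ) (B : Matrix (Fin n) (Fin m) ℝ) (U : Set (Vec m))

theorem hamiltonian_eq : hamiltonian A B U = fun x p =>
    -inner ℝ (Matrix.toEuclideanCLM (n := Fin n) (𝕜 := ℝ) A x) p
      + supportFn (fun α : U => -act B α) p := by
  funext x p
  rw [hamiltonian, supportFn, ← adjoint_inner_right, adjoint_toEuclideanCLM]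
  rfl

theorem transformedHamiltonian_eq (s : ℝ) (p : Vec n) :
    transformedHamiltonian A B U s p
      = supportFn (fun α : U => -act B α) (flow Aᵀ (-s) p) := by
  rw [transformedHamiltonian, supportFn]
  congr 1
  funext α
  rw [act_exp, ← adjoint_flow, adjoint_inner_right, map_neg]

/-- Time reversal `s ↦ t - s`: with `q = e^{-tAᵀ} p`, the group law gives `e^{(t-s)Aᵀ} q = e^{-sAᵀ}
p`. -/
theorem integral_transformedHamiltonian (t : ℝ) (p : Vec n) :
    ∫ s in (0 : ℝ)..t, transformedHamiltonian A B U s p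
      = ∫ r in (0 : ℝ)..t, supportFn (fun α : U => -act B α)
          (adjoint (flow A r) (flow Aᵀ (-t) p)) := by
  have h := intervalIntegral.integral_comp_sub_left (a := 0) (b := t)
    (fun r => supportFn (fun α : U => -act B α) (adjoint (flow A r) (flow Aᵀ (-t) p))) t
  rw [sub_self, sub_zero] at h
  rw [← h]
  congr 1
  funext s
  rw [transformedHamiltonian_eq, adjoint_flow, ← mul_apply_eq_comp, ← flow_add,
    sub_add_eq_add_sub, add_neg_cancel, zero_sub]

theorem hopfObjective_eq (J : Vec n → ℝ) (x : Vec n) (t : ℝ) (p : Vec n) :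
    hopfObjective A B U J x t p = fenchel J (flow Aᵀ (-t) p) +
      (((∫ r in (0 : ℝ)..t, supportFn (fun α : U => -act B α)
        (adjoint (flow A r) (flow Aᵀ (-t) p)))
        - inner ℝ (flow A t x) (flow Aᵀ (-t) p) : ℝ) : EReal) := by
  rw [hopfObjective, integral_transformedHamiltonian, act_exp, ← adjoint_inner_right,
    adjoint_flow A t, flow_flow_neg]

variable {A B U}

/-- The generalized Hopf formula. -/
theorem isLeast_range_hopfObjective (hH : HamiltonianFinite B U) {J : Vec n → ℝ}
    (hJc : Continuous J) (hJ : ConvexOn ℝ univ J) {T : ℝ} {φ : Vec n × ℝ → ℝ}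
    (hφ : IsViscositySolution (hamiltonian A B U) J T φ) (x : Vec n) {t : ℝ}
    (ht : t ∈ Icc 0 T) :
    IsLeast (range (hopfObjective A B U J x t)) ((-(φ (x, t)) : ℝ) : EReal) := by
  obtain ⟨hU, hv⟩ := hH
  have : Nonempty U := hU.to_subtype
  obtain ⟨hφc, hφ0, hsub, hsuper⟩ := hφ
  rw [hamiltonian_eq] at hsub hsuper
  obtain ⟨M, -, hM⟩ := exists_norm_le_of_bddAbove_inner hv
  have hlower : ∀ p, ((-(φ (x, t)) : ℝ) : EReal) ≤ hopfObjective A B U J x t p := by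
    intro p
    rw [hopfObjective_eq]
    set q := flow Aᵀ (-t) p
    have hle : ∀ y, ((inner ℝ q y - J y : ℝ) : EReal) ≤ fenchel J q := fun y =>
      le_iSup (fun y => ((inner ℝ q y - J y : ℝ) : EReal)) y
    -- A finite conjugate value `κ` is exactly the offset of an affine minorant with slope `q`; the
    -- value `⊤` makes the bound trivial, and `⊥` is excluded since `J` is real valued.
    induction hκ : fenchel J q with
    | bot => exact absurd ((hle 0).trans_eq hκ) (not_le.2 (EReal.bot_lt_coe _))
    | top => rw [EReal.top_add_coe]; exact le_top
    | coe κ =>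
      have h1 := hsuper.affine_le (flow_zero A) (hasDerivAt_flow A) (continuous_supportFn hv)
        (supportFn_sub_le hv hM) hφc hφ0 (q := q) (κ := κ)
        (fun y => EReal.coe_le_coe_iff.1 ((hle y).trans_eq hκ)) (x := x) ht
      rw [← EReal.coe_add, EReal.coe_le_coe_iff]
      linarith
  refine ⟨?_, by rintro _ ⟨p, rfl⟩; exact hlower p⟩
  obtain ⟨q, hq⟩ := hsub.exists_affine_ge (flow_zero A) (hasDerivAt_flow A) hv hJc hJ hφc hφ0 x ht
  -- The minimizer is `p = e^{tAᵀ} q`, which undoes the substitution.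
  refine ⟨flow Aᵀ t q, le_antisymm ?_ (hlower _)⟩
  have hinv : flow Aᵀ (-t) (flow Aᵀ t q) = q := by
    simpa using flow_flow_neg Aᵀ (-t) q
  rw [hopfObjective_eq, hinv]
  calc _ ≤ _ := add_le_add_left (iSup_le fun y => EReal.coe_le_coe_iff.2 (hq y)) _
    _ = _ := by rw [← EReal.coe_add]; congr 1; ring

theorem intervalIntegrable_transformedHamiltonian (hH : HamiltonianFinite B U) (t : ℝ)
    (p : Vec n) : IntervalIntegrable (fun s => transformedHamiltonian A B U s p)
      MeasureTheory.volume 0 t := by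
  have : Nonempty U := hH.1.to_subtype
  simp only [transformedHamiltonian_eq]
  exact ((continuous_supportFn hH.2).comp
    (((continuous_flow Aᵀ).comp continuous_neg).clm_apply continuous_const)).intervalIntegrable _ _

end Matrices

end VehicleHJ

theorem theorem2 {N : ℕ} {n m : Fin N → ℕ}
    (A : ∀ i, Matrix (Fin (n i)) (Fin (n i)) ℝ)
    (B : ∀ i, Matrix (Fin (n i)) (Fin (m i)) ℝ)
    (U : ∀ i, Set (VehicleHJ.Vec (m i)))
    (hUconv : ∀ i, Convex ℝ (U i))
    (hHfin : ∀ i, VehicleHJ.HamiltonianFinite (B i) (U i))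
    (Ω : ∀ i, Fin N → Set (VehicleHJ.Vec (n i)))
    (hΩclosed : ∀ i j, IsClosed (Ω i j))
    (hΩconv : ∀ i j, Convex ℝ (Ω i j))
    (J : ∀ i, Fin N → VehicleHJ.Vec (n i) → ℝ)
    (hJΩ : ∀ i j, Ω i j = {x | J i j x ≤ 0})
    (hJcont : ∀ i j, Continuous (J i j))
    (hJconv : ∀ i j, ConvexOn ℝ Set.univ (J i j))
    (T : ℝ)
    (φ : ∀ i, Fin N → VehicleHJ.Vec (n i) × ℝ → ℝ)
    (hφ : ∀ i j, VehicleHJ.IsViscositySolution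
      (VehicleHJ.hamiltonian (A i) (B i) (U i)) (J i j) T (φ i j)) :
    ∀ (i j : Fin N) (x : VehicleHJ.Vec (n i)) (t : ℝ), t ∈ Set.Icc 0 T →
      (∀ p : VehicleHJ.Vec (n i), IntervalIntegrable
        (fun s => VehicleHJ.transformedHamiltonian (A i) (B i) (U i) s p)
        MeasureTheory.volume 0 t) ∧
      IsLeast (Set.range (VehicleHJ.hopfObjective (A i) (B i) (U i) (J i j) x t))
        ((-(φ i j (x, t)) : ℝ) : EReal) := by
  intro i j x t ht
  exact ⟨VehicleHJ.intervalIntegrable_transformedHamiltonian (hHfin i) t,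
    VehicleHJ.isLeast_range_hopfObjective (hHfin i) (hJcont i j) (hJconv i j) (hφ i j) x ht⟩
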